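/- **Setting.** Let $N$ be a finite set. A *virtual manifold* $(\mathcal X,\Phi)$ consists of smooth (Hausdorff, second countable, boundaryless) manifolds $X_I$, one for each $I\subseteq N$, with $X_\emptyset\neq\emptyset$; open subsets $X_{I,J}\subseteq X_I$ for all $I,J\subseteq N$; and smooth vector bundles $\phi_{J,I}:X_{J,I}\to X_{I,J}$ (surjective) for $I\subseteq J$, with $X_{I,I}=X_I$ and $\phi_{I,I}=\mathrm{id}$, such that for all $I,J$: $X_{I\cup J,I\cap J}=X_{I\cup J,I}\cap X_{I\cup J,J}$; $X_{I\cap J,I\cup J}=X_{I\cap J,I}\cap X_{I\cap J,J}$; $\phi_{I\cup J,I\cap J}=\phi_{I,I\cap J}\circ\phi_{I\cup J,I}$ as partially defined maps; $X_{I,J}=\phi_{I\cup J,I}(X_{I\cup J,I\cap J})=\phi_{I,I\cap J}^{-1}(X_{I\cap J,I\cup J})$; and $(\phi_{I\cup J,I},\phi_{I\cup J,J})$ identifies $X_{I\cup J,I\cap J}$ diffeomorphically with $X_{I,J}\times_{X_{I\cap J,I\cup J}}X_{J,I}$. For such a family, points $x\in X_I$, $y\in X_J$ are equivalent if $\phi_{I,K}(x)=\phi_{J,K}(y)$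 (both being defined) for some $K\subseteq I\cap J$. The *virtual space* $\mathbf X=\bigcup_I X_I/\!\sim$ has the quotient topology; $\pi_I:X_I\to\mathbf X$ is the projection, $[U]=\pi_I(U)$ for $U\subseteq X_I$. The *support* of $p\in\mathbf X$ is the $X_I$ with $p\in[X_I]$ and $p\notin[X_J]$ for all $J\subsetneq I$. The virtual space is assumed to have the following separation property (automatic if $\mathbf X$ is Hausdorff): for every $I$ and $p\in[X_I]$ there is a continuous $f:\mathbf X\to\mathbb R$ with $f(p)\ne0$ and $f=0$ outside $[X_I]$. A family $\mathcal W=(W_I)$ of open sets $W_I\subseteq X_I$ is *pre-compact* if, with $[\mathcal W]=\bigcup_I[W_I]$, the closure $\overline{[\mathcal W]}$ in $\mathbf X$ is compact; the closure of $\pi_I^{-1}(p)\cap W_I$ in $X_I$ is compact for all $I$ and $p\in[X_I]$; and $\phi_{J,I}(X_{J,I}\cap W_J)=X_{I,J}\cap W_I$ for $I\subseteq J$. **Modification.** Let $\Gamma$ be a collection of sets of the form $U=\pi_I^{-1}(V)$, where $X_I$ is the support of some $p\in\mathbf X$ and $V$ is an open neighbourhood of $p$, such that the sets $[U]$ cover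 $\mathbf X$. Let $X_I'\subseteq X_I$ be the union of the members of $\Gamma$ in $X_I$, put $Y_I=[X_I']$, and let $Y_I^\circ$ be open sets with $\overline{Y_I^\circ}\subseteq Y_I$ that still cover $\mathbf X$. For a set $S$ of subsets of $N$ put $S_{\max}=\bigcup_{I\in S}I$, $$Y_S=\bigcap_{I\in S}Y_I\setminus\bigcup_{I\notin S}\overline{Y_I^\circ}\quad(S\neq\emptyset),\qquad Y_S=\emptyset\quad(S=\emptyset),$$ $Z_S=\pi_{S_{\max}}^{-1}(Y_S)$, an open subset of $X_{S_{\max}}$, $Z_{S,T}=\pi_{S_{\max}}^{-1}(Y_S\cap Y_T)$, and for $S\subseteq T$ let $\Psi_{T,S}:Z_{T,S}\to Z_{S,T}$ be the restriction of $\phi_{T_{\max},S_{\max}}$. The family $\mathcal Z_\Gamma=(\{Z_S\},\{\Psi_{T,S}\})$ is the modification of $\mathcal X$; its virtual space $\mathbf Z_\Gamma$ (with projections $\pi_S:Z_S\to\mathbf Z_\Gamma$ and images $[Z_S]$) is formed as above from the $Z_S$ and $\Psi_{T,S}$. Let $\mathcal W_\Gamma=(W_{S_{\max}}\cap Z_S)_S$,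 and let $[\mathcal W_\Gamma]\subseteq\mathbf Z_\Gamma$ be the union of the images of its members. **Lemma.** Let $(\mathcal X,\Phi)$ be a virtual manifold as above and $\mathcal W$ a pre-compact family on it. Then, for a suitable choice of $\Gamma$ and of the sets $Y_I^\circ$, the modification $\mathcal Z_\Gamma$ admits a smooth partition of unity with respect to $\mathcal W_\Gamma$: there are open sets $Y'_S\subseteq\mathbf Z_\Gamma$ with $\overline{Y'_S}\subseteq[Z_S]$ and $\overline{[\mathcal W_\Gamma]}\subseteq\bigcup_S Y'_S$, and functions $\eta_S:\mathbf Z_\Gamma\to[0,\infty)$ such that $\sum_S\eta_S=1$ on $[\mathcal W_\Gamma]$, $\operatorname{supp}\eta_S\subseteq Y'_S$, and $\pi_S^*\eta_S$ is smooth on $\pi_S^{-1}(Y'_S)$ for all $S$. -/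

import Mathlib

open scoped Manifold ContDiff

universe u v

noncomputable section

/-- The model space of a `d`-dimensional manifold without boundary. -/
abbrev Euc (d : ℕ) : Type := EuclideanSpace ℝ (Fin d)

/-! ### Smooth vector bundles -/

section Bundle

variable {d e : ℕ} {E : Type u} [TopologicalSpace E] [ChartedSpace (Euc e) E]
  {B : Type v} [TopologicalSpace B] [ChartedSpace (Euc d) B]

/-- The map `τ : E → ℝᵏ` is the fibre coordinate of a local trivialisation of `f : E → B` over the
open set `O`: the map `x ↦ (f x, τ x)` is a diffeomorphism from `f ⁻¹' O` onto `O × ℝᵏ`. -/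
structure IsLocalTriv (f : E → B) (O : Set B) (k : ℕ) (τ : E → Euc k) : Prop where
  isOpen : IsOpen O
  smooth : ContMDiffOn 𝓘(ℝ, Euc e) 𝓘(ℝ, Euc k) ∞ τ (f ⁻¹' O)
  inverse : ∃ g : B × Euc k → E,
    ContMDiffOn (𝓘(ℝ, Euc d).prod 𝓘(ℝ, Euc k)) 𝓘(ℝ, Euc e) ∞ g (O ×ˢ Set.univ) ∧
    (∀ x, f x ∈ O → g (f x, τ x) = x) ∧
    (∀ b ∈ O, ∀ v, f (g (b, v)) = b ∧ τ (g (b, v)) = v)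

/-- `f : E → B` is (the projection of) a smooth real vector bundle over the open subset `U` of `B`:
it is smooth with image `U`, and `U` is covered by local trivialisations whose changes of
coordinates are linear on every fibre. -/
def IsSmoothVectorBundle (d e : ℕ) {E : Type u} [TopologicalSpace E] [ChartedSpace (Euc e) E]
    {B : Type v} [TopologicalSpace B] [ChartedSpace (Euc d) B] (f : E → B) (U : Set B) : Prop :=
  ContMDiff 𝓘(ℝ, Euc e) 𝓘(ℝ, Euc d) ∞ f ∧ Set.range f = U ∧
  ∃ 𝒜 : Set (Set B × (Σ k : ℕ, E → Euc k)),
    (∀ t ∈ 𝒜, IsLocalTriv (d := d) (e := e) f t.1 t.2.1 t.2.2) ∧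
    (∀ b ∈ U, ∃ t ∈ 𝒜, b ∈ t.1) ∧
    (∀ t ∈ 𝒜, ∀ t' ∈ 𝒜, ∀ b ∈ t.1 ∩ t'.1,
      ∃ L : Euc t.2.1 →ₗ[ℝ] Euc t'.2.1, ∀ x, f x = b → t'.2.2 x = L (t.2.2 x))

theorem IsSmoothVectorBundle.isOpenMap {f : E → B} {U : Set B} (hf : IsSmoothVectorBundle d e f U) :
    IsOpenMap f := by
  obtain ⟨-, hr, 𝒜, h1, h2, -⟩ := hf
  rw [isOpenMap_iff_nhds_le]
  intro x N hN
  obtain ⟨t, ht, hxt⟩ := h2 (f x) (hr ▸ Set.mem_range_self x)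
  obtain ⟨ho, -, g, hg, hgl, hgr⟩ := h1 t ht
  have hc : ContinuousAt (fun b => g (b, t.2.2 x)) (f x) := by
    have h3 : ContinuousAt g (f x, t.2.2 x) :=
      (hg.continuousOn).continuousAt ((ho.prod isOpen_univ).mem_nhds ⟨hxt, trivial⟩)
    exact ContinuousAt.comp (f := fun b => (b, t.2.2 x)) h3 (by fun_prop)
  have h4 : ∀ᶠ b in nhds (f x), g (b, t.2.2 x) ∈ f ⁻¹' N := by
    apply hc
    change f ⁻¹' N ∈ nhds (g (f x, t.2.2 x))
    rw [hgl x hxt]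
    exact hN
  filter_upwards [h4, ho.mem_nhds hxt] with b hb hbO
  have := (hgr b hbO (t.2.2 x)).1
  simpa [this] using hb

end Bundle

/-! ### Families of manifolds with overlap maps -/

/-- A family `(X_I)` of smooth manifolds (without boundary, Hausdorff, second countable), indexed by
the subsets `I` of a finite set `ι`, together with open subsets `ov I J = X_{I,J} ⊆ X_I` and maps
`φ_{J,I} : X_{J,I} → X_I` for `I ⊆ J`. No compatibility is required yet. -/
structure PatchData (ι : Type v) where
  /-- the dimension of `X_I` -/
  dim : Finset ι → ℕ
  /-- the manifold `X_I` -/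
  X : Finset ι → Type u
  top : ∀ I, TopologicalSpace (X I)
  charted : ∀ I, ChartedSpace (Euc (dim I)) (X I)
  manifold : ∀ I, IsManifold 𝓘(ℝ, Euc (dim I)) ∞ (X I)
  t2 : ∀ I, T2Space (X I)
  secondCountable : ∀ I, SecondCountableTopology (X I)
  /-- the open subset `X_{I,J}` of `X_I` -/
  ov : ∀ I : Finset ι, Finset ι → TopologicalSpace.Opens (X I)
  /-- the map `φ_{J,I}`, for `I ⊆ J` -/
  φ : ∀ {I J : Finset ι}, I ⊆ J → ov J I → X I

attribute [instance] PatchData.top PatchData.charted PatchData.manifold PatchData.t2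
  PatchData.secondCountable

namespace PatchData

variable {ι : Type v} (𝒳 : PatchData.{u, v} ι)

/-- The relation `x ∼ y` for `x ∈ X_I`, `y ∈ X_J`: there is `K ⊆ I ∩ J` such that `φ_{I,K} x` and
`φ_{J,K} y` are defined and equal. -/
def Rel (a b : Σ I, 𝒳.X I) : Prop :=
  ∃ (K : Finset ι) (ha : K ⊆ a.1) (hb : K ⊆ b.1) (ma : a.2 ∈ 𝒳.ov a.1 K) (mb : b.2 ∈ 𝒳.ov b.1 K),
    𝒳.φ ha ⟨a.2, ma⟩ = 𝒳.φ hb ⟨b.2, mb⟩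

/-- The virtual space `𝐗 = (⋃ X_I) / ∼`. -/
def VSpace : Type (max u v) := Quot 𝒳.Rel

/-- The virtual space carries the quotient topology. -/
instance : TopologicalSpace 𝒳.VSpace := inferInstanceAs (TopologicalSpace (Quot 𝒳.Rel))

/-- The projection `π_I : X_I → 𝐗` (also written `φ_I`). -/
def proj (I : Finset ι) (x : 𝒳.X I) : 𝒳.VSpace := Quot.mk 𝒳.Rel ⟨I, x⟩

/-- `[X_I] = π_I(X_I)`. -/
def piece (I : Finset ι) : Set 𝒳.VSpace := Set.range (𝒳.proj I)

/-- `X_I` is the support of the point `p`: `p` lies in `[X_I]` and in no `[X_J]` with `J ⊊ I`. -/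
def IsSupport (I : Finset ι) (p : 𝒳.VSpace) : Prop :=
  p ∈ 𝒳.piece I ∧ ∀ J, J ⊂ I → p ∉ 𝒳.piece J

/-- `[𝒲] = ⋃ [W_I]` for a family of subsets `W_I ⊆ X_I`. -/
def total (W : ∀ I, Set (𝒳.X I)) : Set 𝒳.VSpace := ⋃ I, 𝒳.proj I '' W I

/-- Pre-compact families `𝒲 = (W_I)` of open subsets `W_I ⊆ X_I`. -/
structure PreCompact (W : ∀ I, Set (𝒳.X I)) : Prop where
  isOpen : ∀ I, IsOpen (W I)
  /-- the closure of `[𝒲]` in the virtual space is compact -/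
  a1 : IsCompact (closure (𝒳.total W))
  /-- the closure of `π_I⁻¹(p) ∩ W_I` is compact, for `p ∈ [X_I]` -/
  a2 : ∀ I, ∀ p ∈ 𝒳.piece I, IsCompact (closure (𝒳.proj I ⁻¹' {p} ∩ W I))
  /-- `φ_{J,I}(X_{J,I} ∩ W_J) = X_{I,J} ∩ W_I` for `I ⊆ J` -/
  a3 : ∀ I J (h : I ⊆ J), 𝒳.φ h '' {x | (x : 𝒳.X J) ∈ W J} = (𝒳.ov I J : Set (𝒳.X I)) ∩ W I

/-- Open sets `Y_I ⊆ [X_I]` whose closures (in the virtual space) are still contained in `[X_I]` and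
which together cover the closure of `[𝒲]`. -/
structure IsCover (W : ∀ I, Set (𝒳.X I)) (Y : Finset ι → Set 𝒳.VSpace) : Prop where
  isOpen : ∀ I, IsOpen (Y I)
  b1 : closure (𝒳.total W) ⊆ ⋃ I, Y I
  b2 : ∀ I, closure (Y I) ⊆ 𝒳.piece I

/-- `(η_I)` is a smooth partition of unity with respect to `𝒲`, with supports in the sets `Y_I`. -/
structure IsSmoothPartitionOfUnity [Fintype ι] (W : ∀ I, Set (𝒳.X I))
    (Y : Finset ι → Set 𝒳.VSpace) (η : Finset ι → 𝒳.VSpace → ℝ) : Prop where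
  nonneg : ∀ I p, 0 ≤ η I p
  sum_eq_one : ∀ p ∈ 𝒳.total W, ∑ I, η I p = 1
  /-- the support of `η_I` (a closure in the virtual space) lies in `Y_I` -/
  c1 : ∀ I, tsupport (η I) ⊆ Y I
  /-- `π_I^* η_I` is smooth on `π_I⁻¹(Y_I)` -/
  c2 : ∀ I, ContMDiffOn 𝓘(ℝ, Euc (𝒳.dim I)) 𝓘(ℝ, ℝ) ∞
    (fun x => η I (𝒳.proj I x)) (𝒳.proj I ⁻¹' Y I)

end PatchData

/-! ### Virtual manifolds -/

/-- A virtual manifold. The conditions are stated for all `I`, `J`; exchanging `I` and `J` gives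
the conditions on `X_{J,I}`, `φ_{I∪J,J}` and `φ_{J,I∩J}`. -/
structure VirtualManifold (ι : Type v) [DecidableEq ι] extends PatchData.{u, v} ι where
  nonempty_empty : Nonempty (X ∅)
  ov_self : ∀ I, ov I I = ⊤
  φ_self : ∀ (I : Finset ι) (x : ov I I), φ (subset_refl I) x = x
  /-- `φ_{J,I} : X_{J,I} → X_{I,J}` is a surjective smooth vector bundle. (The restriction of
  `φ_{I,I∩J}` to `X_{I,J}`, the preimage of the open set `X_{I∩J,I∪J}`, is then one as well.) -/
  bundle : ∀ {I J : Finset ι} (h : I ⊆ J), IsSmoothVectorBundle (dim I) (dim J) (φ h) (ov I J : Set (X I))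
  P1 : ∀ I J, (ov (I ∪ J) (I ∩ J) : Set (X (I ∪ J))) =
    (ov (I ∪ J) I : Set (X (I ∪ J))) ∩ (ov (I ∪ J) J : Set (X (I ∪ J)))
  P2 : ∀ I J, (ov (I ∩ J) (I ∪ J) : Set (X (I ∩ J))) =
    (ov (I ∩ J) I : Set (X (I ∩ J))) ∩ (ov (I ∩ J) J : Set (X (I ∩ J)))
  /-- `φ_{I∪J,I∩J} = φ_{I,I∩J} ∘ φ_{I∪J,I}` as partially defined maps: both sides have the same
  domain … -/
  P3_dom : ∀ (I J : Finset ι) (x : X (I ∪ J)), x ∈ ov (I ∪ J) (I ∩ J) ↔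
    ∃ h1 : x ∈ ov (I ∪ J) I, φ Finset.subset_union_left ⟨x, h1⟩ ∈ ov I (I ∩ J)
  /-- … and the same values. -/
  P3_val : ∀ (I J : Finset ι) (x : X (I ∪ J)) (hx : x ∈ ov (I ∪ J) (I ∩ J))
    (h1 : x ∈ ov (I ∪ J) I) (h2 : φ Finset.subset_union_left ⟨x, h1⟩ ∈ ov I (I ∩ J)),
    φ Finset.inter_subset_union ⟨x, hx⟩ =
      φ Finset.inter_subset_left ⟨φ Finset.subset_union_left ⟨x, h1⟩, h2⟩
  /-- `X_{I,J} = φ_{I∪J,I}(X_{I∪J,I∩J})` -/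
  P4_image : ∀ I J : Finset ι, (ov I J : Set (X I)) =
    φ (Finset.subset_union_left (s₁ := I) (s₂ := J)) '' {x | (x : X (I ∪ J)) ∈ ov (I ∪ J) (I ∩ J)}
  /-- `X_{I,J} = φ_{I,I∩J}⁻¹(X_{I∩J,I∪J})` -/
  P4_preimage : ∀ I J : Finset ι, (ov I J : Set (X I)) =
    (fun x : ov I (I ∩ J) => (x : X I)) ''
      (φ (Finset.inter_subset_left (s₁ := I) (s₂ := J)) ⁻¹' (ov (I ∩ J) (I ∪ J)))
  /-- `X_{I∪J,I∩J}` is the fibre product of `X_{I,J}` and `X_{J,I}` over `X_{I∩J,I∪J}`: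
  `x ↦ (φ_{I∪J,I} x, φ_{I∪J,J} x)` is a bijection onto the fibre product … -/
  fibreProduct : ∀ (I J : Finset ι) (a : ov I (I ∩ J)) (b : ov J (I ∩ J)),
    (a : X I) ∈ ov I J → (b : X J) ∈ ov J I →
    φ Finset.inter_subset_left a = φ Finset.inter_subset_right b →
    ∃! x : X (I ∪ J), x ∈ ov (I ∪ J) (I ∩ J) ∧
      ∃ (h1 : x ∈ ov (I ∪ J) I) (h2 : x ∈ ov (I ∪ J) J),
        φ Finset.subset_union_left ⟨x, h1⟩ = a ∧ φ Finset.subset_union_right ⟨x, h2⟩ = b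
  /-- … with smooth inverse. (Nothing is required if `X_{I∪J}` is empty; the fibre product is then
  empty as well.) -/
  fibreProduct_smooth : ∀ I J : Finset ι, Nonempty (X (I ∪ J)) →
    ∃ g : X I × X J → X (I ∪ J),
      ContMDiffOn (𝓘(ℝ, Euc (dim I)).prod 𝓘(ℝ, Euc (dim J))) 𝓘(ℝ, Euc (dim (I ∪ J))) ∞ g
        {p | ∃ (hI : p.1 ∈ ov I (I ∩ J)) (hJ : p.2 ∈ ov J (I ∩ J)),
          p.1 ∈ ov I J ∧ p.2 ∈ ov J I ∧
          φ Finset.inter_subset_left ⟨p.1, hI⟩ = φ Finset.inter_subset_right ⟨p.2, hJ⟩} ∧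
      ∀ (x : X (I ∪ J)) (_ : x ∈ ov (I ∪ J) (I ∩ J))
        (h1 : x ∈ ov (I ∪ J) I) (h2 : x ∈ ov (I ∪ J) J),
        g (φ Finset.subset_union_left ⟨x, h1⟩, φ Finset.subset_union_right ⟨x, h2⟩) = x

namespace VirtualManifold

variable {ι : Type v} [DecidableEq ι] (𝒳 : VirtualManifold.{u, v} ι)

/-- For `K ⊆ L ⊆ J`: `φ_{J,K} = φ_{L,K} ∘ φ_{J,L}` as partially defined maps. -/
theorem φ_comp {K L J : Finset ι} (hKL : K ⊆ L) (hLJ : L ⊆ J) (x : 𝒳.X J) (hx : x ∈ 𝒳.ov J K) :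
    ∃ (h1 : x ∈ 𝒳.ov J L) (h2 : 𝒳.φ hLJ ⟨x, h1⟩ ∈ 𝒳.ov L K),
      𝒳.φ (hKL.trans hLJ) ⟨x, hx⟩ = 𝒳.φ hKL ⟨𝒳.φ hLJ ⟨x, h1⟩, h2⟩ := by
  have e1 : J = L ∪ (K ∪ (J \ L)) := by ext a; simp; grind
  have e2 : K = L ∩ (K ∪ (J \ L)) := by ext a; simp; grind
  generalize K ∪ (J \ L) = M at e1 e2
  subst e1 e2
  obtain ⟨h1, h2⟩ := (𝒳.P3_dom L M x).1 hx
  exact ⟨h1, h2, 𝒳.P3_val L M x hx h1 h2⟩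

theorem mem_ov_trans {K L J : Finset ι} (hKL : K ⊆ L) (hLJ : L ⊆ J) (x : 𝒳.X J)
    (h1 : x ∈ 𝒳.ov J L) (h2 : 𝒳.φ hLJ ⟨x, h1⟩ ∈ 𝒳.ov L K) : x ∈ 𝒳.ov J K := by
  have e1 : J = L ∪ (K ∪ (J \ L)) := by ext a; simp; grind
  have e2 : K = L ∩ (K ∪ (J \ L)) := by ext a; simp; grind
  generalize K ∪ (J \ L) = M at e1 e2
  subst e1 e2
  exact (𝒳.P3_dom L M x).2 ⟨h1, h2⟩

theorem φ_mem {I J : Finset ι} (h : I ⊆ J) (x : 𝒳.ov J I) : 𝒳.φ h x ∈ 𝒳.ov I J := by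
  change 𝒳.φ h x ∈ (𝒳.ov I J : Set (𝒳.X I))
  rw [← (𝒳.bundle h).2.1]
  exact Set.mem_range_self x

theorem φ_surj {I J : Finset ι} (h : I ⊆ J) (p : 𝒳.X I) (hp : p ∈ 𝒳.ov I J) :
    ∃ x : 𝒳.ov J I, 𝒳.φ h x = p := by
  have := (𝒳.bundle h).2.1
  change p ∈ Set.range (𝒳.φ h)
  rw [this]; exact hp

/-- `X_{J,K} ∩ X_{J,L} ⊆ X_{J,K∩L}` for `K, L ⊆ J`. -/
theorem mem_ov_inter {K L J : Finset ι} (hK : K ⊆ J) (hL : L ⊆ J) (x : 𝒳.X J)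
    (h1 : x ∈ 𝒳.ov J K) (h2 : x ∈ 𝒳.ov J L) : x ∈ 𝒳.ov J (K ∩ L) := by
  have e1 : J = K ∪ (L ∪ (J \ K)) := by ext a; simp; grind
  have e2 : K ∩ L = K ∩ (L ∪ (J \ K)) := by ext a; simp; grind
  have hLM : L ⊆ L ∪ (J \ K) := Finset.subset_union_left
  have hMJ : L ∪ (J \ K) ⊆ J := Finset.union_subset hL Finset.sdiff_subset
  obtain ⟨h3, -, -⟩ := 𝒳.φ_comp hLM hMJ x h2
  rw [e2]
  clear hLM hMJ e2 h2 hL hK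
  generalize L ∪ (J \ K) = M at *
  subst e1
  have : x ∈ (𝒳.ov (K ∪ M) (K ∩ M) : Set _) := by rw [𝒳.P1]; exact ⟨h1, h3⟩
  exact this

/-- `X_{K,I} ∩ X_{K,J} ⊆ X_{K,I∪J}` for `K ⊆ I`, `K ⊆ J`. -/
theorem mem_ov_union {K I J : Finset ι} (hI : K ⊆ I) (hJ : K ⊆ J) (p : 𝒳.X K)
    (h1 : p ∈ 𝒳.ov K I) (h2 : p ∈ 𝒳.ov K J) : p ∈ 𝒳.ov K (I ∪ J) := by
  have e1 : I ∪ J = I ∪ (K ∪ (J \ I)) := by ext a; simp; grind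
  have e2 : K = I ∩ (K ∪ (J \ I)) := by ext a; simp; grind
  have hKM : K ⊆ K ∪ (J \ I) := Finset.subset_union_left
  have hMJ : K ∪ (J \ I) ⊆ J := Finset.union_subset hJ Finset.sdiff_subset
  have h3 : p ∈ 𝒳.ov K (K ∪ (J \ I)) := by
    obtain ⟨⟨x, hx⟩, hxp⟩ := 𝒳.φ_surj hJ p h2
    obtain ⟨m1, m2, e⟩ := 𝒳.φ_comp hKM hMJ x hx
    have := 𝒳.φ_mem hKM ⟨_, m2⟩
    rw [← e, hxp] at this
    exact this
  rw [e1]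
  clear hKM hMJ e1 h2 hI hJ
  generalize K ∪ (J \ I) = M at *
  subst e2
  have : p ∈ (𝒳.ov (I ∩ M) (I ∪ M) : Set _) := by rw [𝒳.P2]; exact ⟨h1, h3⟩
  exact this

theorem rel_equivalence : Equivalence 𝒳.Rel where
  refl a := ⟨a.1, subset_refl _, subset_refl _, by rw [𝒳.ov_self]; trivial,
    by rw [𝒳.ov_self]; trivial, rfl⟩
  symm := by
    rintro a b ⟨K, ha, hb, ma, mb, e⟩
    exact ⟨K, hb, ha, mb, ma, e.symm⟩
  trans := by
    rintro a b c ⟨K, ha, hb, ma, mb, e⟩ ⟨L, hb', hc, mb', mc, e'⟩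
    have m := 𝒳.mem_ov_inter hb hb' b.2 mb mb'
    have hK : K ∩ L ⊆ K := Finset.inter_subset_left
    have hL : K ∩ L ⊆ L := Finset.inter_subset_right
    obtain ⟨_, p2, p3⟩ := 𝒳.φ_comp hK hb b.2 m
    obtain ⟨_, q2, q3⟩ := 𝒳.φ_comp hL hb' b.2 m
    have p2' : 𝒳.φ ha ⟨a.2, ma⟩ ∈ 𝒳.ov K (K ∩ L) := by rw [e]; exact p2
    have q2' : 𝒳.φ hc ⟨c.2, mc⟩ ∈ 𝒳.ov L (K ∩ L) := by rw [← e']; exact q2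
    have na := 𝒳.mem_ov_trans hK ha a.2 ma p2'
    have nc := 𝒳.mem_ov_trans hL hc c.2 mc q2'
    obtain ⟨_, _, r3⟩ := 𝒳.φ_comp hK ha a.2 na
    obtain ⟨_, _, s3⟩ := 𝒳.φ_comp hL hc c.2 nc
    refine ⟨K ∩ L, hK.trans ha, hL.trans hc, na, nc, ?_⟩
    rw [r3, s3]
    simp only [e, ← e']
    rw [← p3, ← q3]

theorem proj_eq_iff {I J : Finset ι} (x : 𝒳.X I) (y : 𝒳.X J) :
    𝒳.proj I x = 𝒳.proj J y ↔ 𝒳.Rel ⟨I, x⟩ ⟨J, y⟩ :=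
  ⟨fun h => 𝒳.rel_equivalence.eqvGen_iff.1 (Quot.eqvGen_exact h), fun h => Quot.sound h⟩

/-- For `I ⊆ J`, a point of `X_J` whose class lies in `[X_I]` belongs to `X_{J,I}`. -/
theorem mem_ov_of_proj_mem {I J : Finset ι} (h : I ⊆ J) (x : 𝒳.X J)
    (hx : 𝒳.proj J x ∈ 𝒳.piece I) : x ∈ 𝒳.ov J I := by
  obtain ⟨y, hy⟩ := hx
  obtain ⟨K, ha, hb, ma, mb, -⟩ := (𝒳.proj_eq_iff y x).1 hy
  exact (𝒳.φ_comp ha h x mb).1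

theorem proj_φ {I J : Finset ι} (h : I ⊆ J) (x : 𝒳.ov J I) :
    𝒳.proj I (𝒳.φ h x) = 𝒳.proj J x := by
  rw [𝒳.proj_eq_iff]
  have m : 𝒳.φ h x ∈ 𝒳.ov I I := by rw [𝒳.ov_self]; trivial
  exact ⟨I, subset_refl _, h, m, x.2, 𝒳.φ_self I ⟨_, m⟩⟩

/-- `[X_I] ∩ [X_J] ⊆ [X_{I∪J}]`. -/
theorem piece_inter_subset (I J : Finset ι) :
    𝒳.piece I ∩ 𝒳.piece J ⊆ 𝒳.piece (I ∪ J) := by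
  rintro _ ⟨⟨x, rfl⟩, ⟨y, hy⟩⟩
  obtain ⟨K, hJ, hI, mJ, mI, e⟩ := (𝒳.proj_eq_iff y x).1 hy
  have h1 := 𝒳.φ_mem hI ⟨x, mI⟩
  have h2 := 𝒳.φ_mem hJ ⟨y, mJ⟩
  rw [e] at h2
  have hK : K ⊆ I ∪ J := hI.trans Finset.subset_union_left
  obtain ⟨z, hz⟩ := 𝒳.φ_surj hK _ (𝒳.mem_ov_union hI hJ _ h1 h2)
  refine ⟨z, ?_⟩
  rw [← 𝒳.proj_φ hK z, hz]
  exact 𝒳.proj_φ hI ⟨x, mI⟩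

theorem continuous_proj (I : Finset ι) : Continuous (𝒳.proj I) :=
  continuous_quot_mk.comp (continuous_sigmaMk (σ := 𝒳.X))

theorem isOpenMap_proj (I : Finset ι) : IsOpenMap (𝒳.proj I) := by
  intro U hU
  refine isQuotientMap_quot_mk.isOpen_preimage.1 ?_
  rw [isOpen_sigma_iff]
  intro J
  have key : (Sigma.mk J ⁻¹' (Quot.mk 𝒳.Rel ⁻¹' (𝒳.proj I '' U)) : Set (𝒳.X J)) =
      ⋃ (K : Finset ι) (hI : K ⊆ I) (hJ : K ⊆ J),
        (fun y : 𝒳.ov J K => (y : 𝒳.X J)) ''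
          (𝒳.φ hJ ⁻¹' (𝒳.φ hI '' ((fun x : 𝒳.ov I K => (x : 𝒳.X I)) ⁻¹' U))) := by
    ext y
    simp only [Set.mem_preimage, Set.mem_image, Set.mem_iUnion]
    constructor
    · rintro ⟨x, hx, e⟩
      obtain ⟨K, hI, hJ, mI, mJ, e⟩ := (𝒳.proj_eq_iff x y).1 e
      exact ⟨K, hI, hJ, ⟨y, mJ⟩, ⟨⟨x, mI⟩, hx, e⟩, rfl⟩
    · rintro ⟨K, hI, hJ, ⟨y, mJ⟩, ⟨⟨x, mI⟩, hx, e⟩, rfl⟩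
      exact ⟨x, hx, (𝒳.proj_eq_iff x y).2 ⟨K, hI, hJ, mI, mJ, e⟩⟩
  refine (congrArg IsOpen key).mpr ?_
  refine isOpen_iUnion fun K => isOpen_iUnion fun hI => isOpen_iUnion fun hJ => ?_
  refine (𝒳.ov J K).isOpen.isOpenMap_subtype_val _ ?_
  exact ((𝒳.bundle hI).isOpenMap _ (hU.preimage continuous_subtype_val)).preimage
    (𝒳.bundle hJ).1.continuous

/-- The separation property of the virtual space used below: each point of `[X_I]` can be separated
from the complement of `[X_I]` by a continuous function. -/
def PiecesSeparated : Prop :=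
  ∀ I, ∀ p ∈ 𝒳.piece I, ∃ f : 𝒳.VSpace → ℝ,
    Continuous f ∧ f p ≠ 0 ∧ ∀ q, q ∉ 𝒳.piece I → f q = 0

/-! ### The modification of a virtual manifold -/

/-- The collection `𝒩_{[x]}` of the open sets `π_I⁻¹(V) ⊆ X_I`, for the points `[x]` with support
`X_I` and the open neighbourhoods `V` of `[x]` in the virtual space. -/
def nhdSets (I : Finset ι) : Set (Set (𝒳.X I)) :=
  {U | ∃ p, 𝒳.IsSupport I p ∧ ∃ V : Set 𝒳.VSpace, IsOpen V ∧ p ∈ V ∧ U = 𝒳.proj I ⁻¹' V}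

/-- The choices that enter the modification `𝒵_Γ`: a collection `Γ` of sets `U ∈ 𝒩_{[x]}` whose
images cover the virtual space (`Γ I` consists of the members of `Γ` contained in `X_I`), and a
shrinking `Y_I°` of the resulting open cover `Y_I = [X'_I]`, `X'_I = ⋃_{U ∈ Γ, U ⊆ X_I} U`. -/
structure ModificationDatum where
  Γ : ∀ I, Set (Set (𝒳.X I))
  Γ_subset : ∀ I, Γ I ⊆ 𝒳.nhdSets I
  covers : ⋃ I, 𝒳.proj I '' (⋃₀ Γ I) = Set.univ
  /-- the smaller open sets `Y_I°` -/
  shrink : Finset ι → Set 𝒳.VSpace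
  shrink_open : ∀ I, IsOpen (shrink I)
  closure_shrink : ∀ I, closure (shrink I) ⊆ 𝒳.proj I '' (⋃₀ Γ I)
  shrink_covers : ⋃ I, shrink I = Set.univ

namespace ModificationDatum

variable {𝒳}
variable (D : 𝒳.ModificationDatum)

/-- `Y_I = [X'_I]`. -/
def Y (I : Finset ι) : Set 𝒳.VSpace := 𝒳.proj I '' (⋃₀ D.Γ I)

theorem Y_subset (I : Finset ι) : D.Y I ⊆ 𝒳.piece I := Set.image_subset_range _ _

theorem isOpen_Y (I : Finset ι) : IsOpen (D.Y I) := by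
  refine 𝒳.isOpenMap_proj I _ (isOpen_sUnion fun U hU => ?_)
  obtain ⟨p, -, V, hV, -, rfl⟩ := D.Γ_subset I hU
  exact hV.preimage (𝒳.continuous_proj I)

/-- The cover indexed by sets `S` of subsets of `ι`:
`Y_S = ⋂_{I ∈ S} Y_I ∖ ⋃_{I ∉ S} closure(Y_I°)`, and `Y_∅ = Y_{(∅)} ∖ ⋃_I closure(Y_I°)`
(which is empty because the `Y_I°` cover). -/
def cell (S : Finset (Finset ι)) : Set 𝒳.VSpace :=
  {p | (∀ I ∈ S, p ∈ D.Y I) ∧ (S = ∅ → p ∈ D.Y ∅) ∧ ∀ I, I ∉ S → p ∉ closure (D.shrink I)}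

/-- `S_max = ⋃_{I ∈ S} I`, so `∅_max = ∅`. -/
abbrev max (S : Finset (Finset ι)) : Finset ι := S.sup id

theorem max_mono {S T : Finset (Finset ι)} (h : S ⊆ T) : max S ⊆ max T := Finset.sup_mono h

theorem cell_subset (S : Finset (Finset ι)) : D.cell S ⊆ 𝒳.piece (max S) := by
  rintro p ⟨h1, h2, -⟩
  rcases S.eq_empty_or_nonempty with rfl | hS
  · exact D.Y_subset ∅ (h2 rfl)
  clear h2
  induction hS using Finset.Nonempty.cons_induction with
  | singleton a => simpa [max] using D.Y_subset a (h1 a (by simp))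
  | cons a s ha hs ih =>
    have h3 := ih fun I hI => h1 I (by simp [hI])
    have h4 := D.Y_subset a (h1 a (by simp))
    have := 𝒳.piece_inter_subset a (max s) ⟨h4, h3⟩
    simpa [max] using this

theorem isOpen_cell [Finite ι] (S : Finset (Finset ι)) : IsOpen (D.cell S) := by
  have : D.cell S = (⋂ I ∈ S, D.Y I) ∩ ((⋂ _ : S = ∅, D.Y ∅) ∩
      ⋂ (I : Finset ι) (_ : I ∉ S), (closure (D.shrink I))ᶜ) := by
    ext p; simp [cell]
  rw [this]
  refine (isOpen_biInter_finset fun I _ => D.isOpen_Y I).inter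
    ((isOpen_iInter_of_finite fun _ => D.isOpen_Y ∅).inter ?_)
  exact isOpen_iInter_of_finite fun I => isOpen_iInter_of_finite fun _ =>
    isClosed_closure.isOpen_compl

/-- The open subset `Z_S = π⁻¹(Y_S)` of `X_{S_max}`. -/
def Z [Finite ι] (S : Finset (Finset ι)) : TopologicalSpace.Opens (𝒳.X (max S)) :=
  ⟨𝒳.proj (max S) ⁻¹' D.cell S, (D.isOpen_cell S).preimage (𝒳.continuous_proj _)⟩

/-- The modification `𝒵_Γ` of `𝒳`: the manifolds `Z_S`, the overlaps `Z_{S,T} = π⁻¹(Y_S ∩ Y_T)`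
and, for `S ⊆ T`, the maps `Ψ_{T,S} : Z_{T,S} → Z_S` induced by `φ_{T_max,S_max}`. -/
def modification [Finite ι] : PatchData.{u, v} (Finset ι) where
  dim S := 𝒳.dim (max S)
  X S := D.Z S
  top _ := inferInstance
  charted _ := inferInstance
  manifold _ := inferInstance
  t2 _ := inferInstance
  secondCountable _ := inferInstance
  ov S T := ⟨{z | 𝒳.proj (max S) z ∈ D.cell T},
    (D.isOpen_cell T).preimage ((𝒳.continuous_proj _).comp continuous_subtype_val)⟩
  φ {S T} h z :=
    ⟨𝒳.φ (max_mono h) ⟨z.1.1, 𝒳.mem_ov_of_proj_mem (max_mono h) _ (D.cell_subset S z.2)⟩, by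
      change 𝒳.proj _ _ ∈ D.cell S
      rw [𝒳.proj_φ]
      exact z.2⟩

/-- The family `𝒲_Γ = (W_{S_max} ∩ Z_S)` induced on the modification by a family `𝒲` on `𝒳`. -/
def restrict [Finite ι] (W : ∀ I, Set (𝒳.X I)) (S : Finset (Finset ι)) :
    Set (D.modification.X S) :=
  {z | (z : D.Z S).1 ∈ W (max S)}

end ModificationDatum

end VirtualManifold

end

noncomputable section

namespace VirtualManifold

variable {ι : Type v} [DecidableEq ι] (𝒳 : VirtualManifold.{u, v} ι)

/-! ### Supports and lifts of points of the virtual space -/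

/-! Separation and second countability give continuous functions `f I` on 𝐗 with pointwise maximum
1, positive only on [X_I], such that the indices positive at a given point form a chain
(`exists_isChainFamily`). With Y_I = {f_I > 0} and Y_I° = {f_I > 1/2}, the conditions on covers and
supports in 𝐙_Γ become inequalities for the f_I.

The partition of unity is sought as one map into the simplex whose vertices are the sets S. On each
X_I a smooth h_I is built with values in a convex set `weights`, which controls the supports, and
with h_I = h_J ∘ φ_{I,J} wherever f_J ≥ 1/2, J ⊂ I. Both constraints are convex in the value, so
local solutions glue by a partition of unity on the manifold X_I, and one can induct on |I|. A local
solution exists by the chain property: pull back h_J from the largest J ⊂ I with f_J ≥ 1/2, or take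
a constant if there is none (`exists_local_section`, `exists_extension`).

The h_I are not compatible under every φ, so they need not descend to 𝐗. They do descend to 𝐙_Γ
(`descend`): for R ⊆ S, at each point of Z_{S,R} some L ∈ R has f_L = 1, and both h_{S_max} and the
pullback of h_{R_max} equal the pullback of h_L there.

The thresholds 0 < 1/10 < 1/5 < 3/10 < 2/5 < 1/2 nest the supports in the sets Y'_S and the closures
of these in the cells Y_S. -/

theorem exists_mem_piece_of_inter {I J : Finset ι} {p : 𝒳.VSpace} (hI : p ∈ 𝒳.piece I)
    (hJ : p ∈ 𝒳.piece J) : ∃ K, K ⊆ I ∧ K ⊆ J ∧ p ∈ 𝒳.piece K := by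
  obtain ⟨x, rfl⟩ := hI
  obtain ⟨y, hy⟩ := hJ
  obtain ⟨K, hKI, hKJ, mI, mJ, -⟩ := (𝒳.proj_eq_iff x y).1 hy.symm
  exact ⟨K, hKI, hKJ, _, 𝒳.proj_φ hKI ⟨x, mI⟩⟩

variable {𝒳} in
-- Any two pieces through `p` come with a third whose index lies in both, so a minimal index is the
-- least one.
theorem support_subset {I J : Finset ι} {p : 𝒳.VSpace} (h : 𝒳.IsSupport I p)
    (hJ : p ∈ 𝒳.piece J) : I ⊆ J := by
  obtain ⟨K, hKI, hKJ, hK⟩ := 𝒳.exists_mem_piece_of_inter h.1 hJ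
  rcases hKI.eq_or_ssubset with rfl | hs
  · exact hKJ
  · exact absurd hK (h.2 K hs)

theorem exists_isSupport (p : 𝒳.VSpace) : ∃ I, 𝒳.IsSupport I p := by
  have hne : ∃ I, p ∈ 𝒳.piece I := by
    obtain ⟨⟨I, x⟩, rfl⟩ := Quot.exists_rep p
    exact ⟨I, x, rfl⟩
  obtain ⟨I, hI⟩ := hne
  induction I using Finset.strongInduction with
  | H I ih =>
    by_cases h : ∃ J, J ⊂ I ∧ p ∈ 𝒳.piece J
    · obtain ⟨J, hJ, hp⟩ := h
      exact ih J hJ hp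
    · push Not at h
      exact ⟨I, hI, h⟩

/-- For `I ⊆ J`, a point of `X_I` whose class lies in `[X_J]` is the image of a point of `X_J`. -/
theorem exists_φ_eq {I J : Finset ι} (h : I ⊆ J) (y : 𝒳.X I) (hy : 𝒳.proj I y ∈ 𝒳.piece J) :
    ∃ x : 𝒳.ov J I, 𝒳.φ h x = y := by
  obtain ⟨s, hs⟩ := hy
  obtain ⟨K, hKI, hKJ, mI, mJ, e⟩ := (𝒳.proj_eq_iff y s).1 hs.symm
  have hKJ' : 𝒳.φ hKI ⟨y, mI⟩ ∈ 𝒳.ov K J := e ▸ 𝒳.φ_mem hKJ ⟨s, mJ⟩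
  -- With M = K ∪ (J \ I) one has I ∪ M = J and I ∩ M = K. Then `P4_preimage` puts y in X_{I,M}, and
  -- `P4_image` lifts it to X_J.
  have e1 : J = I ∪ (K ∪ (J \ I)) := by ext a; simp; grind
  have e2 : K = I ∩ (K ∪ (J \ I)) := by ext a; simp; grind
  generalize K ∪ (J \ I) = M at e1 e2
  change K ⊆ I at hKI
  clear e hs mJ hKJ s
  subst e1 e2
  have hm : y ∈ (𝒳.ov I M : Set (𝒳.X I)) := by
    rw [𝒳.P4_preimage]
    exact ⟨⟨y, mI⟩, hKJ', rfl⟩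
  rw [𝒳.P4_image] at hm
  obtain ⟨⟨x, hx⟩, -, rfl⟩ := hm
  exact ⟨⟨x, hx⟩, rfl⟩

/-! ### Continuous functions cutting out the pieces -/

variable {𝒳} in
-- As X_I is Lindelöf, countably many separating functions have no common zero on [X_I]. A summable
-- weighting of their truncations min(|g|, 1) converges uniformly to the required function.
theorem PiecesSeparated.exists_continuous_pos_iff (h : 𝒳.PiecesSeparated) (I : Finset ι) :
    ∃ e : 𝒳.VSpace → ℝ, Continuous e ∧ (∀ p, 0 ≤ e p) ∧ ∀ p, 0 < e p ↔ p ∈ 𝒳.piece I := by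
  choose f hf hfp hfz using h I
  let g : 𝒳.X I → 𝒳.VSpace → ℝ := fun x => f _ (Set.mem_range_self x)
  have hopen (x : 𝒳.X I) : IsOpen {y | g x (𝒳.proj I y) ≠ 0} :=
    isOpen_ne.preimage ((hf _ _).comp (𝒳.continuous_proj I))
  obtain ⟨T, hT, hTU⟩ := TopologicalSpace.isOpen_iUnion_countable _ hopen
  have := hT.to_subtype
  obtain ⟨w, hw, c, hc, -⟩ := hT.exists_pos_hasSum_le (ε := 1) one_pos
  let F : T → 𝒳.VSpace → ℝ := fun x p => w x * min |g x p| 1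
  have hF0 (x : T) (p : 𝒳.VSpace) : 0 ≤ F x p :=
    mul_nonneg (hw x).le (le_min (abs_nonneg _) zero_le_one)
  have hFw (x : T) (p : 𝒳.VSpace) : ‖F x p‖ ≤ w x := by
    rw [Real.norm_of_nonneg (hF0 x p)]
    exact mul_le_of_le_one_right (hw x).le (min_le_right _ _)
  have hFc (x : T) : Continuous (F x) :=
    continuous_const.mul ((hf _ _).abs.min continuous_const)
  refine ⟨fun p => ∑' x, F x p, continuous_tsum hFc hc.summable hFw,
    fun p => tsum_nonneg fun x => hF0 x p, fun p => ⟨fun hp => ?_, ?_⟩⟩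
  · by_contra hpI
    have hz (x : T) : F x p = 0 := by
      have hg : g x p = 0 := hfz _ _ p hpI
      simp [F, hg]
    simp [hz] at hp
  · rintro ⟨y, rfl⟩
    have hy : y ∈ ⋃ x ∈ T, {y | g x (𝒳.proj I y) ≠ 0} := by
      rw [hTU]
      exact Set.mem_iUnion.2 ⟨y, hfp _ _⟩
    obtain ⟨x, hxT, hx⟩ := Set.mem_iUnion₂.1 hy
    exact (Summable.of_norm_bounded hc.summable fun x => hFw x _).tsum_pos (fun x => hF0 x _)
      ⟨x, hxT⟩ (mul_pos (hw x) (lt_min (abs_pos.2 hx) one_pos))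

/-- Continuous functions `f_I : 𝐗 → ℝ` with maximum `1` whose positivity sets lie in `[X_I]`, meet
the stratum of points with support `X_I` unless empty, and are disjoint for incomparable indices. -/
structure IsChainFamily (f : Finset ι → 𝒳.VSpace → ℝ) : Prop where
  continuous : ∀ I, Continuous (f I)
  exists_eq_one : ∀ p, ∃ I, f I p = 1
  mem_piece : ∀ I p, 0 < f I p → p ∈ 𝒳.piece I
  exists_isSupport : ∀ I p, 0 < f I p → ∃ q, 𝒳.IsSupport I q ∧ 0 < f I q
  comparable : ∀ I J p, 0 < f I p → 0 < f J p → I ⊆ J ∨ J ⊆ I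

variable {𝒳} in
open Classical in
-- From each e_I subtract all e_J with J incomparable to I: two incomparable positive remainders
-- would give e_J < e_I < e_J. At a point with support X_I every piece through it has index J ⊇ I,
-- so nothing is lost there. Hence some remainder is positive at each point, and dividing by the
-- maximum is legitimate.
theorem PiecesSeparated.exists_isChainFamily [Finite ι] (h : 𝒳.PiecesSeparated) :
    ∃ f, 𝒳.IsChainFamily f := by
  have := Fintype.ofFinite ι
  choose e₀ he₀c he₀n he₀p using h.exists_continuous_pos_iff
  -- If no point has support X_I, then Γ can have no member in X_I, so Y_I must be empty.
  let e : Finset ι → 𝒳.VSpace → ℝ := fun I p => if ∃ q, 𝒳.IsSupport I q then e₀ I p else 0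
  have hec (I) : Continuous (e I) := by
    by_cases hI : ∃ q, 𝒳.IsSupport I q
    · simpa [e, hI] using he₀c I
    · simpa [e, hI] using continuous_const
  have hen (I p) : 0 ≤ e I p := by
    dsimp only [e]
    split_ifs
    exacts [he₀n I p, le_rfl]
  have hep (I p) (hp : 0 < e I p) : p ∈ 𝒳.piece I ∧ ∃ q, 𝒳.IsSupport I q := by
    dsimp only [e] at hp
    split_ifs at hp with hI
    exacts [⟨(he₀p I p).1 hp, hI⟩, absurd hp (lt_irrefl _)]
  have hes (I p) (hp : 𝒳.IsSupport I p) : 0 < e I p := by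
    have hI : ∃ q, 𝒳.IsSupport I q := ⟨p, hp⟩
    simpa [e, hI] using (he₀p I p).2 hp.1
  let r : Finset ι → 𝒳.VSpace → ℝ := fun I p =>
    max 0 (e I p - ∑ J with ¬ I ⊆ J ∧ ¬ J ⊆ I, e J p)
  have hrc (I) : Continuous (r I) :=
    continuous_const.max ((hec I).sub (continuous_finsetSum _ fun J _ => hec J))
  have hre (I p) (hp : 0 < r I p) : 0 < e I p := by
    have h1 := Finset.sum_nonneg fun J (_ : J ∈ Finset.univ.filter fun J => ¬ I ⊆ J ∧ ¬ J ⊆ I) =>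
      hen J p
    have h2 := (lt_max_iff.1 hp).resolve_left (lt_irrefl _)
    linarith
  have hrs (I p) (hp : 𝒳.IsSupport I p) : 0 < r I p := by
    refine lt_max_of_lt_right ?_
    rw [Finset.sum_eq_zero, sub_zero]
    · exact hes I p hp
    · intro J hJ
      by_contra hne
      exact (Finset.mem_filter.1 hJ).2.1
        (support_subset hp (hep J p ((hen J p).lt_of_ne' hne)).1)
  have hrlt (I J p) (hp : 0 < r I p) (h1 : ¬ I ⊆ J) (h2 : ¬ J ⊆ I) : e J p < e I p := by
    have h3 := Finset.single_le_sum (f := fun J => e J p)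
      (s := Finset.univ.filter fun J => ¬ I ⊆ J ∧ ¬ J ⊆ I) (fun J _ => hen J p)
      (Finset.mem_filter.2 ⟨Finset.mem_univ J, h1, h2⟩)
    have h4 := (lt_max_iff.1 hp).resolve_left (lt_irrefl _)
    linarith
  let m : 𝒳.VSpace → ℝ := fun p => Finset.univ.sup' Finset.univ_nonempty fun I => r I p
  have hmc : Continuous m := Continuous.finset_sup'_apply _ fun I _ => hrc I
  have hm (p) : 0 < m p := by
    obtain ⟨I, hI⟩ := 𝒳.exists_isSupport p
    exact (hrs I p hI).trans_le (Finset.le_sup' (fun I => r I p) (Finset.mem_univ I))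
  have hpos {I p} (hp : 0 < r I p / m p) : 0 < r I p := (div_pos_iff_of_pos_right (hm p)).1 hp
  refine ⟨fun I p => r I p / m p, fun I => (hrc I).div₀ hmc fun p => (hm p).ne', fun p => ?_,
    fun I p hp => (hep I p (hre I p (hpos hp))).1, fun I p hp => ?_, fun I J p hI hJ => ?_⟩
  · obtain ⟨I, -, hI⟩ := Finset.exists_mem_eq_sup' Finset.univ_nonempty fun I => r I p
    exact ⟨I, (div_eq_one_iff_eq (hm p).ne').2 hI.symm⟩
  · obtain ⟨q, hq⟩ := (hep I p (hre I p (hpos hp))).2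
    exact ⟨q, hq, div_pos (hrs I q hq) (hm q)⟩
  · by_contra! hc
    exact (hrlt I J p (hpos hI) hc.1 hc.2).asymm (hrlt J I p (hpos hJ) hc.2 hc.1)

namespace IsChainFamily

variable {𝒳} {f : Finset ι → 𝒳.VSpace → ℝ} (hf : 𝒳.IsChainFamily f)

/-! ### The modification defined by a chain family -/

/-- The modification datum with `Y_I = {f_I > 0}` and `Y_I° = {f_I > 1/2}`. -/
def datum : 𝒳.ModificationDatum :=
  have himage (I) : {p | 0 < f I p} ⊆ 𝒳.proj I ''
      ⋃₀ {U | ∃ q, (𝒳.IsSupport I q ∧ 0 < f I q) ∧ U = 𝒳.proj I ⁻¹' {p | 0 < f I p}} := by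
    intro p hp
    obtain ⟨q, hq⟩ := hf.exists_isSupport I p hp
    obtain ⟨x, rfl⟩ := hf.mem_piece I p hp
    exact ⟨x, ⟨_, ⟨q, hq, rfl⟩, hp⟩, rfl⟩
  -- The point q only certifies that U is admissible; `Γ I` is empty or a singleton.
  { Γ := fun I => {U | ∃ q, (𝒳.IsSupport I q ∧ 0 < f I q) ∧ U = 𝒳.proj I ⁻¹' {p | 0 < f I p}}
    Γ_subset := by
      rintro I U ⟨q, hq, rfl⟩
      exact ⟨q, hq.1, _, isOpen_lt continuous_const (hf.continuous I), hq.2, rfl⟩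
    covers := by
      refine Set.eq_univ_of_forall fun p => ?_
      obtain ⟨I, hI⟩ := hf.exists_eq_one p
      exact Set.mem_iUnion.2 ⟨I, himage I (by simp [hI])⟩
    shrink := fun I => {p | 1 / 2 < f I p}
    shrink_open := fun I => isOpen_lt continuous_const (hf.continuous I)
    closure_shrink := fun I => Set.Subset.trans
      (closure_lt_subset_le continuous_const (hf.continuous I))
      fun p (hp : 1 / 2 ≤ f I p) => himage I (show 0 < f I p by linarith)
    shrink_covers := by
      refine Set.eq_univ_of_forall fun p => ?_
      obtain ⟨I, hI⟩ := hf.exists_eq_one p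
      refine Set.mem_iUnion.2 ⟨I, ?_⟩
      change 1 / 2 < f I p
      rw [hI]
      norm_num }

theorem mem_Y_datum {I : Finset ι} {p : 𝒳.VSpace} (hp : 0 < f I p) : p ∈ hf.datum.Y I := by
  obtain ⟨q, hq⟩ := hf.exists_isSupport I p hp
  obtain ⟨x, rfl⟩ := hf.mem_piece I p hp
  exact ⟨x, ⟨_, ⟨q, hq, rfl⟩, hp⟩, rfl⟩

theorem le_of_mem_closure_shrink {I : Finset ι} {p : 𝒳.VSpace}
    (hp : p ∈ closure (hf.datum.shrink I)) : 1 / 2 ≤ f I p :=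
  closure_lt_subset_le continuous_const (hf.continuous I) hp

/-- A point of the cell `Y_S` has an index `I ∈ S` with `f_I = 1`. -/
theorem exists_mem_of_mem_cell {S : Finset (Finset ι)} {p : 𝒳.VSpace} (hp : p ∈ hf.datum.cell S) :
    ∃ I ∈ S, f I p = 1 := by
  obtain ⟨I, hI⟩ := hf.exists_eq_one p
  refine ⟨I, ?_, hI⟩
  by_contra hIS
  refine hp.2.2 I hIS (subset_closure ?_)
  change 1 / 2 < f I p
  rw [hI]
  norm_num

theorem mem_cell {S : Finset (Finset ι)} {p : 𝒳.VSpace} (h1 : ∀ I ∈ S, 0 < f I p)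
    (h2 : ∀ I ∉ S, f I p < 1 / 2) : p ∈ hf.datum.cell S := by
  refine ⟨fun I hI => hf.mem_Y_datum (h1 I hI), ?_, fun I hI hc =>
    (h2 I hI).not_ge (hf.le_of_mem_closure_shrink hc)⟩
  rintro rfl
  obtain ⟨I, hI⟩ := hf.exists_eq_one p
  have := h2 I (Finset.notMem_empty I)
  rw [hI] at this
  norm_num at this

/-- An index with f_I = 1 lies in both S and T, so S ∩ T is nonempty. This makes S ∩ T usable as the
common lower index relating points of Z_S and Z_T. -/
theorem mem_cell_inter {S T : Finset (Finset ι)} {p : 𝒳.VSpace} (hS : p ∈ hf.datum.cell S)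
    (hT : p ∈ hf.datum.cell T) : p ∈ hf.datum.cell (S ∩ T) := by
  refine ⟨fun I hI => hS.1 I (Finset.mem_inter.1 hI).1, fun h => ?_, fun I hI => ?_⟩
  · obtain ⟨I, hI, h1⟩ := hf.exists_mem_of_mem_cell hS
    have hIT : I ∉ T := fun hIT => Finset.notMem_empty I (h ▸ Finset.mem_inter.2 ⟨hI, hIT⟩)
    refine absurd (subset_closure ?_) (hT.2.2 I hIT)
    change 1 / 2 < f I p
    rw [h1]
    norm_num
  · by_cases h : I ∈ S
    · exact hT.2.2 I fun h' => hI (Finset.mem_inter.2 ⟨h, h'⟩)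
    · exact hS.2.2 I h

variable [Fintype ι]

/-- The projection of the virtual space of the modification to the original virtual space. -/
def toVSpace : hf.datum.modification.VSpace → 𝒳.VSpace :=
  Quot.lift (fun a => 𝒳.proj (ModificationDatum.max a.1) a.2.1) (by
    rintro ⟨S, x⟩ ⟨T, y⟩ ⟨R, hRS, hRT, mS, mT, e⟩
    have e' := congrArg (fun z => 𝒳.proj _ z.1) e
    exact (𝒳.proj_φ (ModificationDatum.max_mono hRS) _).symm.trans
      (e'.trans (𝒳.proj_φ (ModificationDatum.max_mono hRT) _)))

theorem continuous_toVSpace : Continuous hf.toVSpace := by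
  refine continuous_quot_lift _ (continuous_sigma fun S => ?_)
  exact (𝒳.continuous_proj _).comp continuous_subtype_val

/-- Map a representative in Z_T down to level S ∩ T and lift the image to X_{S_max}. The lift must
be of that very point and not just of its class in 𝐗, because equivalence in 𝐙_Γ is tested at the
levels R_max only. -/
theorem mem_modification_piece {S : Finset (Finset ι)} {q : hf.datum.modification.VSpace}
    (hq : hf.toVSpace q ∈ hf.datum.cell S) : q ∈ hf.datum.modification.piece S := by
  obtain ⟨⟨T, z⟩, rfl⟩ := Quot.exists_rep q
  change 𝒳.proj (ModificationDatum.max T) z.1 ∈ hf.datum.cell S at hq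
  have hST := hf.mem_cell_inter hq z.2
  have hS := Finset.inter_subset_left (s₁ := S) (s₂ := T)
  have hT := Finset.inter_subset_right (s₁ := S) (s₂ := T)
  have mz : z.1 ∈ 𝒳.ov (ModificationDatum.max T) (ModificationDatum.max (S ∩ T)) :=
    𝒳.mem_ov_of_proj_mem (ModificationDatum.max_mono hT) _ (hf.datum.cell_subset _ hST)
  have hpr := 𝒳.proj_φ (ModificationDatum.max_mono hT) ⟨z.1, mz⟩
  obtain ⟨x, hx⟩ := 𝒳.exists_φ_eq (ModificationDatum.max_mono hS)
    (𝒳.φ (ModificationDatum.max_mono hT) ⟨z.1, mz⟩) (by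
      rw [hpr]
      exact hf.datum.cell_subset _ hq)
  have hxp : 𝒳.proj (ModificationDatum.max S) x.1 = 𝒳.proj (ModificationDatum.max T) z.1 := by
    rw [← hpr, ← hx, 𝒳.proj_φ]
  have hxS : 𝒳.proj (ModificationDatum.max S) x.1 ∈ hf.datum.cell S := by rwa [hxp]
  refine ⟨⟨x.1, hxS⟩, Quot.sound ⟨S ∩ T, hS, hT, ?_, hST, ?_⟩⟩
  · change 𝒳.proj (ModificationDatum.max S) x.1 ∈ hf.datum.cell (S ∩ T)
    rwa [hxp]
  · exact Subtype.ext hx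

/-! ### The partition of unity -/

variable (f) in
/-- The vectors `(v_S)` in the standard simplex such that `v_S = 0` unless `f_I(p) ≥ 1/5` for
`I ∈ S` and `f_I(p) ≤ 3/10` for `I ∉ S`. -/
def weights (p : 𝒳.VSpace) : Set (Finset (Finset ι) → ℝ) :=
  {v | (∀ S, 0 ≤ v S) ∧ ∑ S, v S = 1 ∧
    ∀ S, v S ≠ 0 → (∀ I ∈ S, 1 / 5 ≤ f I p) ∧ ∀ I ∉ S, f I p ≤ 3 / 10}

/-- A coordinate that is nonzero in a convex combination is nonzero in one of the two vectors, which
supplies the bounds on the f_I. -/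
theorem convex_weights (p : 𝒳.VSpace) : Convex ℝ (weights f p) := by
  rintro v ⟨hv0, hv1, hv⟩ w ⟨hw0, hw1, hw⟩ a b ha hb hab
  refine ⟨fun S => add_nonneg (mul_nonneg ha (hv0 S)) (mul_nonneg hb (hw0 S)), ?_, fun S hS => ?_⟩
  · simp only [Pi.add_apply, Pi.smul_apply, smul_eq_mul]
    rw [Finset.sum_add_distrib, ← Finset.mul_sum, ← Finset.mul_sum, hv1, hw1]
    linarith
  · by_cases h : v S = 0
    · refine hw S fun h' => hS ?_
      simp [h, h']
    · exact hv S h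

include hf in
-- The vertex S = {I | f_I(p) > 1/4} works: as 1/5 < 1/4 < 3/10, it stays admissible near p.
theorem eventually_exists_mem_weights (p : 𝒳.VSpace) :
    ∃ v, ∀ᶠ q in nhds p, v ∈ weights f q := by
  classical
  let S : Finset (Finset ι) := {I | 1 / 4 < f I p}
  have h1 : ∀ᶠ q in nhds p, ∀ I, (I ∈ S → 1 / 5 ≤ f I q) ∧ (I ∉ S → f I q ≤ 3 / 10) := by
    refine Filter.eventually_all.2 fun I => ?_
    by_cases hI : 1 / 4 < f I p
    · filter_upwards [(hf.continuous I).continuousAt.eventually (lt_mem_nhds hI)] with q hq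
      exact ⟨fun _ => by linarith, fun h => absurd (by simpa [S] using hI) h⟩
    · have hI' : f I p < 3 / 10 := by linarith
      filter_upwards [(hf.continuous I).continuousAt.eventually (gt_mem_nhds hI')] with q hq
      exact ⟨fun h => absurd (by simpa [S] using h) hI, fun _ => hq.le⟩
  refine ⟨Pi.single S 1, ?_⟩
  filter_upwards [h1] with q hq
  refine ⟨fun T => ?_, by simp, fun T hT => ?_⟩
  · by_cases h : T = S <;> simp [h]
  · obtain rfl : T = S := by
      by_contra h
      exact hT (Pi.single_eq_of_ne h 1)
    exact ⟨fun I => (hq I).1, fun I => (hq I).2⟩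

/-! ### Compatible smooth functions on the manifolds X_I -/

variable (f) in
/-- The member with index `I` of the family `(h_I)` is a smooth function with values in the sets
`weights f`, and it is the pullback of `h_J`, `J ⊂ I`, wherever `f_J ≥ 1/2`. -/
structure IsCompatibleAt (h : ∀ I, 𝒳.X I → Finset (Finset ι) → ℝ) (I : Finset ι) : Prop where
  smooth : ContMDiff 𝓘(ℝ, Euc (𝒳.dim I)) 𝓘(ℝ, Finset (Finset ι) → ℝ) ∞ (h I)
  mem : ∀ x, h I x ∈ weights f (𝒳.proj I x)
  eq : ∀ (J) (hJ : J ⊂ I) (x : 𝒳.ov I J), 1 / 2 ≤ f J (𝒳.proj I x) →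
    h I x = h J (𝒳.φ hJ.subset x)

theorem IsCompatibleAt.eq_of_subset {h : ∀ I, 𝒳.X I → Finset (Finset ι) → ℝ} {I J : Finset ι}
    (hI : IsCompatibleAt f h I) (hJ : J ⊆ I) (x : 𝒳.ov I J) (hx : 1 / 2 ≤ f J (𝒳.proj I x)) :
    h I x = h J (𝒳.φ hJ x) := by
  rcases hJ.eq_or_ssubset with rfl | hs
  · rw [𝒳.φ_self]
  · exact hI.eq J hs x hx

include hf in
-- The pullback of h_J works near x: the inequalities f_K < 1/2 for K ⊄ J are open conditions, so
-- only K ⊆ J impose anything, and for these the compatibility of h_J with h_K suffices.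
theorem exists_local_section {h : ∀ I, 𝒳.X I → Finset (Finset ι) → ℝ} {I J : Finset ι}
    (hJI : J ⊂ I) (hJ : IsCompatibleAt f h J) {x : 𝒳.X I} (hx : x ∈ 𝒳.ov I J)
    (hmax : ∀ K, K ⊂ I → 1 / 2 ≤ f K (𝒳.proj I x) → K ⊆ J) :
    ∃ U ∈ nhds x, ∃ g : 𝒳.X I → Finset (Finset ι) → ℝ,
      ContMDiffOn 𝓘(ℝ, Euc (𝒳.dim I)) 𝓘(ℝ, Finset (Finset ι) → ℝ) ∞ g U ∧
      ∀ y ∈ U, g y ∈ weights f (𝒳.proj I y) ∧ ∀ (K) (hK : K ⊂ I) (hy : y ∈ 𝒳.ov I K),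
        1 / 2 ≤ f K (𝒳.proj I y) → g y = h K (𝒳.φ hK.subset ⟨y, hy⟩) := by
  classical
  let g : 𝒳.X I → Finset (Finset ι) → ℝ := fun y =>
    if hy : y ∈ 𝒳.ov I J then h J (𝒳.φ hJI.subset ⟨y, hy⟩) else 0
  have hg (y : 𝒳.ov I J) : g y = h J (𝒳.φ hJI.subset y) := dif_pos y.2
  have hsub : ∀ᶠ y in nhds x, ∀ K, K ⊂ I → 1 / 2 ≤ f K (𝒳.proj I y) → K ⊆ J := by
    refine Filter.eventually_all.2 fun K => ?_
    by_cases hK : K ⊂ I ∧ ¬ K ⊆ J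
    · have hlt : f K (𝒳.proj I x) < 1 / 2 := by
        by_contra! hc
        exact hK.2 (hmax K hK.1 hc)
      have hc : Continuous fun y => f K (𝒳.proj I y) := (hf.continuous K).comp (𝒳.continuous_proj I)
      filter_upwards [hc.continuousAt.eventually (gt_mem_nhds hlt)] with y hy _ hy'
      exact absurd hy' hy.not_ge
    · exact Filter.Eventually.of_forall fun y h1 _ => by_contra fun h2 => hK ⟨h1, h2⟩
  refine ⟨_, Filter.inter_mem hsub ((𝒳.ov I J).isOpen.mem_nhds hx), g, fun y hy => ?_,
    fun y hy => ?_⟩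
  · have hsm : ContMDiff 𝓘(ℝ, Euc (𝒳.dim I)) 𝓘(ℝ, Finset (Finset ι) → ℝ) ∞
        fun y : 𝒳.ov I J => g y :=
      (hJ.smooth.comp (𝒳.bundle hJI.subset).1).congr hg
    exact (contMDiffAt_subtype_iff.1 (hsm ⟨y, hy.2⟩)).contMDiffWithinAt
  · have hgy := hg ⟨y, hy.2⟩
    have hpr := 𝒳.proj_φ hJI.subset ⟨y, hy.2⟩
    refine ⟨?_, fun K hK hyK hfK => ?_⟩
    · rw [hgy, ← hpr]
      exact hJ.mem _
    · have hKJ := hy.1 K hK hfK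
      obtain ⟨_, m, e⟩ := 𝒳.φ_comp hKJ hJI.subset y hyK
      rw [hgy, e]
      exact hJ.eq_of_subset hKJ ⟨_, m⟩ (by rwa [hpr])

include hf in
-- The admissible values at each point form a convex set, so a smooth selection exists once it
-- exists locally.
theorem exists_extension {h : ∀ I, 𝒳.X I → Finset (Finset ι) → ℝ} {I : Finset ι}
    (hh : ∀ J, J ⊂ I → IsCompatibleAt f h J) :
    ∃ g : 𝒳.X I → Finset (Finset ι) → ℝ,
      ContMDiff 𝓘(ℝ, Euc (𝒳.dim I)) 𝓘(ℝ, Finset (Finset ι) → ℝ) ∞ g ∧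
      ∀ y, g y ∈ weights f (𝒳.proj I y) ∧ ∀ (K) (hK : K ⊂ I) (hy : y ∈ 𝒳.ov I K),
        1 / 2 ≤ f K (𝒳.proj I y) → g y = h K (𝒳.φ hK.subset ⟨y, hy⟩) := by
  have : LocallyCompactSpace (𝒳.X I) := ChartedSpace.locallyCompactSpace (Euc (𝒳.dim I)) _
  let t : 𝒳.X I → Set (Finset (Finset ι) → ℝ) := fun y =>
    {v | v ∈ weights f (𝒳.proj I y) ∧ ∀ (K) (hK : K ⊂ I) (hy : y ∈ 𝒳.ov I K),
        1 / 2 ≤ f K (𝒳.proj I y) → v = h K (𝒳.φ hK.subset ⟨y, hy⟩)}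
  have ht (y) : Convex ℝ (t y) := by
    rintro v ⟨hv, hv'⟩ w ⟨hw, hw'⟩ a b ha hb hab
    refine ⟨convex_weights _ hv hw ha hb hab, fun K hK hy hf => ?_⟩
    rw [hv' K hK hy hf, hw' K hK hy hf, ← add_smul, hab, one_smul]
  obtain ⟨g, hg⟩ := exists_contMDiffMap_forall_mem_convex_of_local (n := ⊤)
    𝓘(ℝ, Euc (𝒳.dim I)) ht fun x => by
      by_cases hx : ∃ J, J ⊂ I ∧ 1 / 2 ≤ f J (𝒳.proj I x)
      · obtain ⟨J, ⟨hJI, hJ⟩, hmax⟩ :=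
          Set.Finite.exists_maximal (Set.toFinite {J | J ⊂ I ∧ 1 / 2 ≤ f J (𝒳.proj I x)}) hx
        refine hf.exists_local_section hJI (hh J hJI) (𝒳.mem_ov_of_proj_mem hJI.subset x
          (hf.mem_piece J _ (by linarith))) fun K hK hfK => ?_
        rcases hf.comparable J K _ (by linarith) (by linarith) with hJK | hKJ
        · exact hmax ⟨hK, hfK⟩ hJK
        · exact hKJ
      · push Not at hx
        obtain ⟨v, hv⟩ := hf.eventually_exists_mem_weights (𝒳.proj I x)
        have hlt : ∀ᶠ y in nhds x, ∀ K, K ⊂ I → f K (𝒳.proj I y) < 1 / 2 := by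
          refine Filter.eventually_all.2 fun K => Filter.eventually_imp_distrib_left.2 fun hK => ?_
          have hc : Continuous fun y => f K (𝒳.proj I y) :=
            (hf.continuous K).comp (𝒳.continuous_proj I)
          exact hc.continuousAt.eventually (gt_mem_nhds (hx K hK))
        refine ⟨_, Filter.inter_mem ((𝒳.continuous_proj I).continuousAt.eventually hv) hlt,
          fun _ => v, contMDiffOn_const, fun y hy => ⟨hy.1, fun K hK _ hfK => ?_⟩⟩
        exact absurd hfK (hy.2 K hK).not_ge
  exact ⟨g, g.contMDiff, hg⟩

include hf in
theorem exists_isCompatibleAt :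
    ∃ h : ∀ I, 𝒳.X I → Finset (Finset ι) → ℝ, ∀ I, IsCompatibleAt f h I := by
  classical
  have key (n : ℕ) : ∃ h : ∀ I, 𝒳.X I → Finset (Finset ι) → ℝ,
      ∀ I, I.card < n → IsCompatibleAt f h I := by
    induction n with
    | zero => exact ⟨fun _ _ => 0, fun I hI => absurd hI (Nat.not_lt_zero _)⟩
    | succ n ih =>
      obtain ⟨h, hh⟩ := ih
      have hext (I : Finset ι) (hI : I.card = n) := hf.exists_extension (h := h) (I := I)
        fun J hJ => hh J (hI ▸ Finset.card_lt_card hJ)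
      choose g hgs hg using hext
      -- Only the members with |I| = n change, so compatibility among smaller index sets is kept.
      let h' : ∀ I, 𝒳.X I → Finset (Finset ι) → ℝ := fun I =>
        if hI : I.card = n then g I hI else h I
      have h'_lt {I : Finset ι} (hI : I.card < n) : h' I = h I := dif_neg hI.ne
      have h'_eq {I : Finset ι} (hI : I.card = n) : h' I = g I hI := dif_pos hI
      refine ⟨h', fun I hI => ?_⟩
      rcases (Nat.lt_succ_iff.1 hI).lt_or_eq with hI | hI
      · refine ⟨?_, ?_, fun J hJ x hx => ?_⟩
        · rw [h'_lt hI]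
          exact (hh I hI).smooth
        · rw [h'_lt hI]
          exact (hh I hI).mem
        · rw [h'_lt hI, h'_lt ((Finset.card_lt_card hJ).trans hI)]
          exact (hh I hI).eq J hJ x hx
      · refine ⟨?_, ?_, fun J hJ x hx => ?_⟩
        · rw [h'_eq hI]
          exact hgs I hI
        · rw [h'_eq hI]
          exact fun x => (hg I hI x).1
        · rw [h'_eq hI, h'_lt (hI ▸ Finset.card_lt_card hJ)]
          exact (hg I hI x).2 J hJ x.2 hx
  obtain ⟨h, hh⟩ := key (Fintype.card ι + 1)
  exact ⟨h, fun I => hh I (Nat.lt_succ_of_le (Finset.card_le_univ I))⟩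

/-! ### Descent to the modification and verification -/

/-- The function on the virtual space of the modification which is `h_{S_max}` on `Z_S`. -/
def descend {h : ∀ I, 𝒳.X I → Finset (Finset ι) → ℝ} (hh : ∀ I, IsCompatibleAt f h I) :
    hf.datum.modification.VSpace → Finset (Finset ι) → ℝ :=
  Quot.lift (fun a => h (ModificationDatum.max a.1) a.2.1) (by
    have key {R S : Finset (Finset ι)} (hRS : R ⊆ S) (z : hf.datum.modification.ov S R) :
        h (ModificationDatum.max S) z.1.1 =
          h (ModificationDatum.max R) (hf.datum.modification.φ hRS z).1 := by
      -- Choosing L in the smaller set R makes both sides comparable with h_L.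
      obtain ⟨L, hL, hL1⟩ := hf.exists_mem_of_mem_cell (S := R) z.2
      have hLR : L ⊆ ModificationDatum.max R := Finset.le_sup (f := id) hL
      have hRS' := ModificationDatum.max_mono hRS
      have hLz : 1 / 2 ≤ f L (𝒳.proj (ModificationDatum.max S) z.1.1) := by
        rw [hL1]
        norm_num
      have mL := 𝒳.mem_ov_of_proj_mem (hLR.trans hRS') z.1.1
        (hf.mem_piece L _ (by rw [hL1]; exact one_pos))
      obtain ⟨m1, m2, e⟩ := 𝒳.φ_comp hLR hRS' z.1.1 mL
      rw [(hh _).eq_of_subset (hLR.trans hRS') ⟨z.1.1, mL⟩ hLz, e]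
      refine ((hh _).eq_of_subset hLR ⟨_, m2⟩ ?_).symm
      rwa [𝒳.proj_φ hRS' ⟨z.1.1, m1⟩]
    rintro ⟨S, x⟩ ⟨T, y⟩ ⟨R, hRS, hRT, mS, mT, e⟩
    exact (key hRS ⟨x, mS⟩).trans ((congrArg (fun z => h _ z.1) e).trans (key hRT ⟨y, mT⟩).symm))

theorem descend_mem_weights {h : ∀ I, 𝒳.X I → Finset (Finset ι) → ℝ}
    (hh : ∀ I, IsCompatibleAt f h I) (q : hf.datum.modification.VSpace) :
    hf.descend hh q ∈ weights f (hf.toVSpace q) := by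
  obtain ⟨⟨S, z⟩, rfl⟩ := Quot.exists_rep q
  exact (hh _).mem z.1

theorem contMDiff_descend_proj {h : ∀ I, 𝒳.X I → Finset (Finset ι) → ℝ}
    (hh : ∀ I, IsCompatibleAt f h I) (S : Finset (Finset ι)) :
    ContMDiff 𝓘(ℝ, Euc (𝒳.dim (ModificationDatum.max S))) 𝓘(ℝ, Finset (Finset ι) → ℝ) ∞
      fun z : hf.datum.Z S => hf.descend hh (hf.datum.modification.proj S z) :=
  (hh (ModificationDatum.max S)).smooth.comp contMDiff_subtype_val

/-- The open subset of the virtual space of the modification where `f_I > 1/10` for `I ∈ S` and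
`f_I < 2/5` for `I ∉ S`. -/
def cover (S : Finset (Finset ι)) : Set hf.datum.modification.VSpace :=
  hf.toVSpace ⁻¹' {p | ∀ I, (I ∈ S → 1 / 10 < f I p) ∧ (I ∉ S → f I p < 2 / 5)}

theorem isClosed_bounds (S : Finset (Finset ι)) (a b : ℝ) : IsClosed
    {q | ∀ I, (I ∈ S → a ≤ f I (hf.toVSpace q)) ∧ (I ∉ S → f I (hf.toVSpace q) ≤ b)} := by
  have hc (I) : Continuous fun q => f I (hf.toVSpace q) :=
    (hf.continuous I).comp hf.continuous_toVSpace
  simp only [Set.ofPred_forall, Set.ofPred_and]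
  exact isClosed_iInter fun I =>
    (isClosed_iInter fun _ => isClosed_le continuous_const (hc I)).inter
      (isClosed_iInter fun _ => isClosed_le (hc I) continuous_const)

theorem isCover (W : ∀ I, Set (𝒳.X I)) :
    hf.datum.modification.IsCover (hf.datum.restrict W) hf.cover where
  isOpen S := by
    refine IsOpen.preimage hf.continuous_toVSpace ?_
    simp only [Set.ofPred_forall, Set.ofPred_and]
    exact isOpen_iInter_of_finite fun I =>
      (isOpen_iInter_of_finite fun _ => isOpen_lt continuous_const (hf.continuous I)).inter
        (isOpen_iInter_of_finite fun _ => isOpen_lt (hf.continuous I) continuous_const)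
  b1 q _ := by
    classical
    refine Set.mem_iUnion.2 ⟨Finset.univ.filter fun I => 1 / 5 < f I (hf.toVSpace q), fun I => ?_⟩
    simp only [Finset.mem_filter, Finset.mem_univ, true_and]
    exact ⟨fun hI => by linarith, fun hI => by linarith⟩
  b2 S q hq := by
    have hsub : hf.cover S ⊆ {q | ∀ I, (I ∈ S → 1 / 10 ≤ f I (hf.toVSpace q)) ∧
        (I ∉ S → f I (hf.toVSpace q) ≤ 2 / 5)} :=
      fun p hp I => ⟨fun hI => ((hp I).1 hI).le, fun hI => ((hp I).2 hI).le⟩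
    have hq' := closure_minimal hsub (hf.isClosed_bounds S _ _) hq
    refine hf.mem_modification_piece (hf.mem_cell (fun I hI => ?_) fun I hI => ?_)
    · linarith [(hq' I).1 hI]
    · linarith [(hq' I).2 hI]

theorem isSmoothPartitionOfUnity {h : ∀ I, 𝒳.X I → Finset (Finset ι) → ℝ}
    (hh : ∀ I, IsCompatibleAt f h I) (W : ∀ I, Set (𝒳.X I)) :
    hf.datum.modification.IsSmoothPartitionOfUnity (hf.datum.restrict W) hf.cover
      fun S q => hf.descend hh q S where
  nonneg S q := (hf.descend_mem_weights hh q).1 S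
  sum_eq_one q _ := (hf.descend_mem_weights hh q).2.1
  c1 S q hq := by
    have hsub : (Function.support fun q => hf.descend hh q S) ⊆
        {q | ∀ I, (I ∈ S → 1 / 5 ≤ f I (hf.toVSpace q)) ∧
          (I ∉ S → f I (hf.toVSpace q) ≤ 3 / 10)} := fun p hp I =>
      ⟨((hf.descend_mem_weights hh p).2.2 S hp).1 I, ((hf.descend_mem_weights hh p).2.2 S hp).2 I⟩
    have hq' := closure_minimal hsub (hf.isClosed_bounds S _ _) hq
    exact fun I => ⟨fun hI => by linarith [(hq' I).1 hI], fun hI => by linarith [(hq' I).2 hI]⟩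
  c2 S := by
    have h1 : ContMDiff 𝓘(ℝ, Finset (Finset ι) → ℝ) 𝓘(ℝ, ℝ) ∞
        fun v : Finset (Finset ι) → ℝ => v S := (contDiff_apply ℝ ℝ S).contMDiff
    exact (h1.comp (hf.contMDiff_descend_proj hh S)).contMDiffOn

end IsChainFamily

end VirtualManifold

end

theorem lemma3p8 {ι : Type v} [Fintype ι] [DecidableEq ι] (𝒳 : VirtualManifold.{u, v} ι)
    (h𝒳 : 𝒳.PiecesSeparated) (W : ∀ I, Set (𝒳.X I)) (hW : 𝒳.PreCompact W) :
    ∃ (D : 𝒳.ModificationDatum) (Y : Finset (Finset ι) → Set D.modification.VSpace)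
      (η : Finset (Finset ι) → D.modification.VSpace → ℝ),
      D.modification.IsCover (D.restrict W) Y ∧
      D.modification.IsSmoothPartitionOfUnity (D.restrict W) Y η := by
  obtain ⟨f, hf⟩ := h𝒳.exists_isChainFamily
  obtain ⟨h, hh⟩ := hf.exists_isCompatibleAt
  exact ⟨hf.datum, hf.cover, _, hf.isCover W, hf.isSmoothPartitionOfUnity hh W⟩
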